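/- Let $\mathcal S$ and $\mathcal A$ be nonempty finite sets (states and actions) and $\gamma\in[0,1)$. For $n=(n_s)_{s\in\mathcal S}$ with all $n_s>0$ put $n^*=\sum_s n_s$ and let $$g(n)=\sum_{s\in\mathcal S}\frac{n_s}{n^*}\,\mathrm{KL}\bigl(\mathrm{Dir}(n+e_s)\,\big\|\,\mathrm{Dir}(n)\bigr)$$ be the expected information gain about a $\mathrm{Dir}(n)$-distributed probability vector from one observation, where $e_s$ is the unit vector at $s$. For an array $\alpha=(\alpha_{s,a,s'})$ of positive reals let $\alpha_{s,a}$ denote both the vector $(\alpha_{s,a,s'})_{s'}$ and its sum $\sum_{s'}\alpha_{s,a,s'}$, and let $\alpha\triangleleft\langle s,a,s'\rangle$ be $\alpha$ with the entry at $\langle s,a,s'\rangle$ increased by $1$. Define $q^{\gamma,1}_\alpha(s,a)=g(\alpha_{s,a})$ and, for $\tau\ge 2$, $$q^{\gamma,\tau}_\alpha(s,a)=g(\alpha_{s,a})+\gamma\sum_{s'}\frac{\alpha_{s,a,s'}}{\alpha_{s,a}}\max_{a'}q^{\gamma,\tau-1}_{\alpha\triangleleft\langle s,a,s'\rangle}(s',a').$$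 A policy $\pi$ assigns to every finite list $h$ of past transitions $\langle s,a,s'\rangle$ and every current state $s$ a probability distribution $\pi(\cdot\mid h,s)$ on $\mathcal A$. Its curiosity Q-value is $q^{\gamma,1}_{\pi,\alpha}(s,a)=g(\alpha_{s,a})$ and, for $\tau\ge2$, $$q^{\gamma,\tau}_{\pi,\alpha}(s,a)=g(\alpha_{s,a})+\gamma\sum_{s'}\frac{\alpha_{s,a,s'}}{\alpha_{s,a}}\sum_{a'}\pi\bigl(a'\mid\langle s,a,s'\rangle,s'\bigr)\,q^{\gamma,\tau-1}_{\pi',\,\alpha\triangleleft\langle s,a,s'\rangle}(s',a'),$$ where $\pi'$ is $\pi$ continued after the transition $\langle s,a,s'\rangle$, that is, $\pi'(\cdot\mid h,x)=\pi(\cdot\mid \langle s,a,s'\rangle h,x)$. Then, for every positive array $\alpha$, every $s,a$ and every policy $\pi$, the limits $q^\gamma_\alpha(s,a)=\lim_{\tau\to\infty}q^{\gamma,\tau}_\alpha(s,a)$ and $q^\gamma_{\pi,\alpha}(s,a)=\lim_{\tau\to\infty}q^{\gamma,\tau}_{\pi,\alpha}(s,a)$ exist in $\mathbb R$, and: 1.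 the family $(q^\gamma_\alpha)_\alpha$ solves the recursion $$q_\alpha(s,a)=g(\alpha_{s,a})+\gamma\sum_{s'}\frac{\alpha_{s,a,s'}}{\alpha_{s,a}}\max_{a'}q_{\alpha\triangleleft\langle s,a,s'\rangle}(s',a')\qquad\text{for all positive }\alpha\text{ and all }s,a;$$ moreover it is bounded, uniformly in $\alpha$, $s$ and $a$, and it is the only bounded family that solves this recursion; 2. $q^\gamma_\alpha(s,a)\ge q^\gamma_{\pi,\alpha}(s,a)$ for every positive $\alpha$, all $s,a$ and every policy $\pi$. -/

import Mathlib

open Filter Topology MeasureTheory ProbabilityTheory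

namespace Curiosity

/-- The Dirichlet distribution `Dir(n)` with parameters `n i > 0`: the law of the vector of
proportions `(X i / ∑ j, X j)`, where the `X i` are independent and `X i ∼ Gamma(n i, 1)`. -/
noncomputable def dirichlet {S : Type*} [Fintype S] (n : S → ℝ) : Measure (S → ℝ) :=
  (Measure.pi fun i => gammaMeasure (n i) 1).map fun x i => x i / ∑ j, x j

/-- The expected immediate information gain `g(n)` about `Θ ∼ Dir(n)` from one observation:
the outcome `s` has predictive probability `n s / ∑ i, n i`, the posterior is then `Dir(n + e_s)`,
and the information gained is the Kullback-Leibler divergence from the prior to the posterior. -/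
noncomputable def gain {S : Type*} [Fintype S] [DecidableEq S] (n : S → ℝ) : ℝ :=
  ∑ s, n s / (∑ i, n i) *
    (InformationTheory.klDiv (dirichlet (Function.update n s (n s + 1))) (dirichlet n)).toReal

section

variable {S A : Type*}

/-- `α ◁ ⟨s, a, s'⟩`: the entry of `α` indexed by `⟨s, a, s'⟩` is increased by `1`. -/
def observe [DecidableEq S] [DecidableEq A] (α : S → A → S → ℝ) (s : S) (a : A) (s' : S) :
    S → A → S → ℝ :=
  fun x b y => if x = s ∧ b = a ∧ y = s' then α x b y + 1 else α x b y

/-- Predictive probability `p_α(s' | s, a) = α_{s,a,s'} / ∑_x α_{s,a,x}`. -/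
noncomputable def pred [Fintype S] (α : S → A → S → ℝ) (s : S) (a : A) (s' : S) : ℝ :=
  α s a s' / ∑ x, α s a x

/-- Admissible Dirichlet parameters: all entries are positive. -/
def Positive (α : S → A → S → ℝ) : Prop := ∀ s a s', 0 < α s a s'

/-- A (possibly randomized, possibly history dependent) policy: `prob h s a` is the probability
of performing `a` in the current state `s` after the list `h` of past transitions
`⟨s, a, s'⟩`, oldest first. -/
structure Policy (S A : Type*) [Fintype A] where
  prob : List (S × A × S) → S → A → ℝ
  nonneg : ∀ h s a, 0 ≤ prob h s a
  sum_one : ∀ h s, ∑ a, prob h s a = 1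

/-- The policy `π` as seen after a first transition `⟨s, a, s'⟩`. -/
def Policy.after [Fintype A] (π : Policy S A) (s : S) (a : A) (s' : S) : Policy S A where
  prob h := π.prob ((s, a, s') :: h)
  nonneg _ := π.nonneg _
  sum_one _ := π.sum_one _

variable [Fintype S] [DecidableEq S] [Fintype A] [DecidableEq A]

/-- `max_a f a` over the finite nonempty action set. -/
noncomputable def maxAction [Nonempty A] (f : A → ℝ) : ℝ :=
  Finset.univ.sup' Finset.univ_nonempty f

/-- The optimal discounted curiosity Q-value `q_α^{γ,τ}(s,a)` with `τ` remaining actions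
(the value `0` at `τ = 0` makes the value at `τ = 1` equal to `g(α_{s,a})`). -/
noncomputable def optQ [Nonempty A] (γ : ℝ) : ℕ → (S → A → S → ℝ) → S → A → ℝ
  | 0 => fun _ _ _ => 0
  | τ + 1 => fun α s a => gain (α s a) +
      γ * ∑ s', pred α s a s' * maxAction fun a' => optQ γ τ (observe α s a s') s' a'

/-- The discounted curiosity Q-value `q_{π,α}^{γ,τ}(s,a)` of a policy `π`: the agent has parameters
`α`, performs `a` in `s`, and follows `π` in the remaining `τ - 1` steps. -/
noncomputable def policyQ (γ : ℝ) : ℕ → Policy S A → (S → A → S → ℝ) → S → A → ℝ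
  | 0 => fun _ _ _ _ => 0
  | τ + 1 => fun π α s a => gain (α s a) +
      γ * ∑ s', pred α s a s' *
        ∑ a', π.prob [(s, a, s')] s' a' *
          policyQ γ τ (π.after s a s') (observe α s a s') s' a'

/-- `q_α^γ(s,a) = lim_{τ → ∞} q_α^{γ,τ}(s,a)`. -/
noncomputable def optQLim [Nonempty A] (γ : ℝ) (α : S → A → S → ℝ) (s : S) (a : A) : ℝ :=
  limUnder atTop fun τ => optQ γ τ α s a

/-- `q_{π,α}^γ(s,a) = lim_{τ → ∞} q_{π,α}^{γ,τ}(s,a)`. -/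
noncomputable def policyQLim (γ : ℝ) (π : Policy S A) (α : S → A → S → ℝ) (s : S) (a : A) : ℝ :=
  limUnder atTop fun τ => policyQ γ τ π α s a

/-- The family `Q` satisfies, at all admissible parameters, the infinite recursion
`Q_α(s,a) = g(α_{s,a}) + γ ∑_{s'} p_α(s'|s,a) max_{a'} Q_{α ◁ ⟨s,a,s'⟩}(s',a')`. -/
def SolvesRecursion [Nonempty A] (γ : ℝ) (Q : (S → A → S → ℝ) → S → A → ℝ) : Prop :=
  ∀ α, Positive α → ∀ s a,
    Q α s a = gain (α s a) +
      γ * ∑ s', pred α s a s' * maxAction fun a' => Q (observe α s a s') s' a'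

/-- The family `Q` is bounded on the admissible parameters. -/
def BoundedFamily (Q : (S → A → S → ℝ) → S → A → ℝ) : Prop :=
  ∃ C : ℝ, ∀ α, Positive α → ∀ s a, |Q α s a| ≤ C

/-- A rule `ρ_α(a|s)` that looks only at the current parameters and the current state, as a policy
for an agent that starts with the parameters `α`. -/
def Policy.ofKnowledge (ρ : (S → A → S → ℝ) → S → A → ℝ) (h0 : ∀ α s a, 0 ≤ ρ α s a)
    (h1 : ∀ α s, ∑ a, ρ α s a = 1) (α : S → A → S → ℝ) : Policy S A where
  prob h s a := ρ (h.foldl (fun β t => observe β t.1 t.2.1 t.2.2) α) s a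
  nonneg _ _ _ := h0 _ _ _
  sum_one _ _ := h1 _ _

/-- For such rules `policyQ` obeys the recursion in `(α, s, a)` alone. -/
theorem policyQ_ofKnowledge (γ : ℝ) (ρ : (S → A → S → ℝ) → S → A → ℝ)
    (h0 : ∀ α s a, 0 ≤ ρ α s a) (h1 : ∀ α s, ∑ a, ρ α s a = 1)
    (τ : ℕ) (α : S → A → S → ℝ) (s : S) (a : A) :
    policyQ γ (τ + 1) (Policy.ofKnowledge ρ h0 h1 α) α s a = gain (α s a) +
      γ * ∑ s', pred α s a s' * ∑ a', ρ (observe α s a s') s' a' *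
        policyQ γ τ (Policy.ofKnowledge ρ h0 h1 (observe α s a s')) (observe α s a s') s' a' :=
  rfl

end

end Curiosity

namespace Curiosity

open scoped ENNReal

/-! ### Gamma laws: scaling, exponential tilting, size-biasing -/

section Gamma

/-! The crux is a bound on the gain that is uniform in the parameters (`gain_le_card`). With `p` the
predictive probability of an outcome, the posterior is at most `1 / p` times the prior
(`dirichlet_update_le`). Hence the divergence is at most `log (1 / p) ≤ 1 / p - 1`, and each term of
the gain is at most `1`. The domination is read off the Gamma representation: observing `s`
size-biases the coordinate `s`, which is at most the total, and the total has conditional mean at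
most `∑ i, n i` given the proportions (`setLIntegral_total_le`). With gains in `[0, |S|]`,
finite-horizon values increase with the horizon and stay below `|S| / (1 - γ)`, so they converge.
Finite sums and maxima pass to the limit, the factor `γ` gives uniqueness, and an average over
actions never exceeds the maximum. -/

theorem measurable_gammaPDF (a r : ℝ) : Measurable (gammaPDF a r) :=
  (measurable_gammaPDFReal a r).ennreal_ofReal

/-- The law `Gamma(a, r)` is the law `Gamma(a, 1)` rescaled by `r⁻¹`. -/
theorem map_inv_mul_gammaMeasure {r : ℝ} (a : ℝ) (hr : 0 < r) :
    (gammaMeasure a 1).map (fun x => r⁻¹ * x) = gammaMeasure a r := by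
  have hm : Measurable fun x : ℝ => r⁻¹ * x := measurable_const_mul _
  have hc : (0 : ℝ) < r⁻¹ := inv_pos.2 hr
  ext s hs
  rw [Measure.map_apply hm hs, gammaMeasure, gammaMeasure, withDensity_apply _ (hm hs),
    withDensity_apply _ hs, ← lintegral_indicator (hm hs), ← lintegral_indicator hs]
  -- Change of variables: Lebesgue measure on the right becomes its rescaled image under `x ↦ r⁻¹ *
  -- x`.
  conv_rhs => rw [← Real.smul_map_volume_mul_left hc.ne']
  rw [lintegral_smul_measure, lintegral_map ((measurable_gammaPDF a r).indicator hs) hm, smul_eq_mul,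
    ← lintegral_const_mul _ (by exact ((measurable_gammaPDF a r).indicator hs).comp hm)]
  refine lintegral_congr fun x => ?_
  by_cases hx : r⁻¹ * x ∈ s
  · rw [Set.indicator_of_mem hx, Set.indicator_of_mem (by exact hx), gammaPDF, gammaPDF,
      ← ENNReal.ofReal_mul (abs_nonneg _), abs_of_pos hc]
    congr 1
    unfold gammaPDFReal
    by_cases h0 : 0 ≤ x
    · rw [if_pos h0, if_pos (by positivity), Real.mul_rpow hc.le h0, Real.inv_rpow hr.le,
        Real.rpow_sub_one hr.ne', mul_inv_cancel_left₀ hr.ne', Real.one_rpow, one_mul]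
      have := (Real.rpow_pos_of_pos hr a).ne'
      field_simp
    · rw [if_neg h0, if_neg (by rw [mul_nonneg_iff_of_pos_left hc]; exact h0), mul_zero]
  · rw [Set.indicator_of_notMem hx, Set.indicator_of_notMem (by exact hx), mul_zero]

theorem gammaMeasure_eq_withDensity_exp {a : ℝ} (ha : 0 < a) (r : ℝ) :
    gammaMeasure a r = (gammaMeasure a 1).withDensity
      (fun x => ENNReal.ofReal (r ^ a * Real.exp ((1 - r) * x))) := by
  rw [gammaMeasure, gammaMeasure, ← withDensity_mul _
    (measurable_gammaPDF a 1) (by fun_prop)]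
  congr 1
  funext x
  rw [Pi.mul_apply, gammaPDF, gammaPDF,
    ← ENNReal.ofReal_mul (gammaPDFReal_nonneg ha one_pos x)]
  congr 1
  unfold gammaPDFReal
  split_ifs
  · rw [Real.one_rpow, show -(r * x) = -(1 * x) + (1 - r) * x by ring, Real.exp_add]
    ring
  · rw [zero_mul]

theorem gammaMeasure_add_one {a : ℝ} (ha : 0 < a) :
    gammaMeasure (a + 1) 1 =
      (gammaMeasure a 1).withDensity (fun x => ENNReal.ofReal (x / a)) := by
  rw [gammaMeasure, gammaMeasure, ← withDensity_mul _
    (measurable_gammaPDF a 1) (by fun_prop)]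
  congr 1
  funext x
  rw [Pi.mul_apply, gammaPDF, gammaPDF,
    ← ENNReal.ofReal_mul (gammaPDFReal_nonneg ha one_pos x)]
  congr 1
  unfold gammaPDFReal
  split_ifs with h
  · have hG := (Real.Gamma_pos_of_pos ha).ne'
    rw [Real.one_rpow, Real.one_rpow, Real.Gamma_add_one ha.ne', add_sub_cancel_right]
    have : x ^ a = x ^ (a - 1) * x := by
      rcases h.eq_or_lt with rfl | h
      · rw [Real.zero_rpow ha.ne', mul_zero]
      · rw [Real.rpow_sub_one h.ne', div_mul_cancel₀ _ h.ne']
    rw [this]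
    field_simp
  · rw [zero_mul]

theorem ae_nonneg_gammaMeasure (a r : ℝ) : ∀ᵐ x ∂gammaMeasure a r, 0 ≤ x := by
  rw [gammaMeasure, ae_withDensity_iff (measurable_gammaPDF a r)]
  refine ae_of_all _ fun x hx => ?_
  by_contra h
  exact hx (gammaPDF_of_neg (not_le.1 h))

end Gamma

/-- It suffices to compare boxes, where independence of the coordinates factorises the integral of
the product density. -/
theorem pi_withDensity {ι : Type*} [Fintype ι] {X : ι → Type*} [∀ i, MeasurableSpace (X i)]
    (μ : ∀ i, Measure (X i)) [∀ i, IsProbabilityMeasure (μ i)] {f : ∀ i, X i → ℝ≥0∞}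
    (hf : ∀ i, Measurable (f i)) [∀ i, SigmaFinite ((μ i).withDensity (f i))] :
    Measure.pi (fun i => (μ i).withDensity (f i)) =
      (Measure.pi μ).withDensity (fun x => ∏ i, f i (x i)) := by
  refine Measure.pi_eq fun s hs => ?_
  have hg : ∀ i, Measurable ((s i).indicator (f i)) := fun i => (hf i).indicator (hs i)
  have hind : (Set.univ.pi s).indicator (fun x : ∀ i, X i => ∏ i, f i (x i)) =
      fun x => ∏ i, (s i).indicator (f i) (x i) := by
    funext x
    by_cases hx : x ∈ Set.univ.pi s
    · rw [Set.indicator_of_mem hx]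
      exact Finset.prod_congr rfl fun i _ => (Set.indicator_of_mem (hx i trivial) _).symm
    · rw [Set.indicator_of_notMem hx]
      obtain ⟨i, hi⟩ : ∃ i, x i ∉ s i := by simpa [Set.mem_pi] using hx
      exact (Finset.prod_eq_zero (Finset.mem_univ i) (Set.indicator_of_notMem hi _)).symm
  rw [withDensity_apply _ (MeasurableSet.univ_pi hs),
    ← lintegral_indicator (MeasurableSet.univ_pi hs), hind,
    lintegral_prod_eq_prod_lintegral_of_indepFun Finset.univ
      (fun i (x : ∀ i, X i) => (s i).indicator (f i) (x i))
      (iIndepFun_pi fun i => (hg i).aemeasurable) fun i => (hg i).comp (measurable_pi_apply i)]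
  refine Finset.prod_congr rfl fun i _ => ?_
  rw [(measurePreserving_eval μ i).lintegral_comp (hg i), lintegral_indicator (hs i),
    withDensity_apply _ (hs i)]

/-! ### Dirichlet laws: the posterior is dominated by the prior -/

section Dirichlet

variable {S : Type*} [Fintype S]

theorem measurable_proportions : Measurable fun (x : S → ℝ) i => x i / ∑ j, x j := by
  fun_prop

theorem isProbabilityMeasure_dirichlet {n : S → ℝ} (hn : ∀ i, 0 < n i) :
    IsProbabilityMeasure (dirichlet n) := by
  have := fun i => isProbabilityMeasure_gammaMeasure (hn i) one_pos
  exact Measure.isProbabilityMeasure_map measurable_proportions.aemeasurable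

theorem ae_nonneg_pi_gammaMeasure {n : S → ℝ} (hn : ∀ i, 0 < n i) :
    ∀ᵐ x ∂Measure.pi fun i => gammaMeasure (n i) 1, ∀ i, 0 ≤ x i := by
  have := fun i => isProbabilityMeasure_gammaMeasure (hn i) one_pos
  rw [ae_all_iff]
  exact fun i => (Measure.tendsto_eval_ae_ae (i := i)).eventually (ae_nonneg_gammaMeasure (n i) 1)

theorem pi_gammaMeasure_eq_withDensity_exp {n : S → ℝ} (hn : ∀ i, 0 < n i) {r : ℝ} (hr : 0 < r) :
    (Measure.pi fun i => gammaMeasure (n i) r) =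
      (Measure.pi fun i => gammaMeasure (n i) 1).withDensity
        fun x => ENNReal.ofReal (r ^ (∑ i, n i) * Real.exp ((1 - r) * ∑ i, x i)) := by
  have := fun i => isProbabilityMeasure_gammaMeasure (hn i) one_pos
  have hsf : ∀ i, SigmaFinite ((gammaMeasure (n i) 1).withDensity
      fun x => ENNReal.ofReal (r ^ n i * Real.exp ((1 - r) * x))) := fun i => by
    rw [← gammaMeasure_eq_withDensity_exp (hn i) r]
    have := isProbabilityMeasure_gammaMeasure (hn i) hr
    infer_instance
  simp_rw [fun i => gammaMeasure_eq_withDensity_exp (hn i) r]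
  rw [pi_withDensity _ fun i => by fun_prop]
  congr 1
  funext x
  rw [← ENNReal.ofReal_prod_of_nonneg fun i _ => by positivity, Finset.prod_mul_distrib,
    ← Real.exp_sum, ← Finset.mul_sum, Real.rpow_sum_of_pos hr]

theorem pi_gammaMeasure_update_add_one [DecidableEq S] {n : S → ℝ} (hn : ∀ i, 0 < n i) (s : S) :
    (Measure.pi fun i => gammaMeasure (Function.update n s (n s + 1) i) 1) =
      (Measure.pi fun i => gammaMeasure (n i) 1).withDensity
        fun x => ENNReal.ofReal (x s / n s) := by
  have := fun i => isProbabilityMeasure_gammaMeasure (hn i) one_pos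
  -- Only the coordinate `s` is size-biased, so the product density collapses to one factor.
  let f : S → ℝ → ℝ≥0∞ := fun i x => if i = s then ENNReal.ofReal (x / n i) else 1
  have hf : ∀ i, Measurable (f i) := fun i => by
    by_cases h : i = s <;> simp only [f, h, if_true, if_false] <;> fun_prop
  have hpos : ∀ i, 0 < Function.update n s (n s + 1) i := fun i => by
    rcases eq_or_ne i s with rfl | h
    · rw [Function.update_self]; linarith [hn i]
    · rw [Function.update_of_ne h]; exact hn i
  have hg : ∀ i, gammaMeasure (Function.update n s (n s + 1) i) 1 =
      (gammaMeasure (n i) 1).withDensity (f i) := fun i => by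
    rcases eq_or_ne i s with rfl | h
    · simp only [Function.update_self, f, if_true]; exact gammaMeasure_add_one (hn i)
    · simp only [Function.update_of_ne h, f, h, if_false]; exact withDensity_one.symm
  have hsf : ∀ i, SigmaFinite ((gammaMeasure (n i) 1).withDensity (f i)) := fun i => by
    rw [← hg i]
    have := isProbabilityMeasure_gammaMeasure (hpos i) one_pos
    infer_instance
  simp_rw [hg]
  rw [pi_withDensity _ hf]
  congr 1
  funext x
  simp only [f, Finset.prod_ite_eq', Finset.mem_univ, if_true]

/-- The total `∑ i, x i` of independent `Gamma(n i, 1)` variables has exponential moments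
`(1 - ε) ^ (-∑ i, n i)`, on every event that depends only on the proportions. -/
theorem setLIntegral_exp_total {n : S → ℝ} (hn : ∀ i, 0 < n i) {ε : ℝ} (hε : ε < 1)
    {B : Set (S → ℝ)} (hB : MeasurableSet B) :
    ∫⁻ x in (fun (x : S → ℝ) i => x i / ∑ j, x j) ⁻¹' B, ENNReal.ofReal (Real.exp (ε * ∑ i, x i))
        ∂(Measure.pi fun i => gammaMeasure (n i) 1) =
      ENNReal.ofReal ((1 - ε) ^ (-∑ i, n i)) * dirichlet n B := by
  have := fun i => isProbabilityMeasure_gammaMeasure (hn i) one_pos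
  have hr : 0 < 1 - ε := sub_pos.2 hε
  have hsf : ∀ i, SigmaFinite ((gammaMeasure (n i) 1).map fun x => (1 - ε)⁻¹ * x) := fun i => by
    have := Measure.isProbabilityMeasure_map (μ := gammaMeasure (n i) 1)
      (measurable_const_mul (1 - ε)⁻¹).aemeasurable
    infer_instance
  have hP := measurable_proportions hB
  -- Changing the common rate rescales all coordinates alike, which the proportions do not see. The
  -- same change of rate is also a tilt by `exp (ε * total)`; equating the two gives the claim.
  have hscale : (Measure.pi fun i => gammaMeasure (n i) (1 - ε))
      ((fun (x : S → ℝ) i => x i / ∑ j, x j) ⁻¹' B) = dirichlet n B := by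
    simp_rw [← fun i => map_inv_mul_gammaMeasure (n i) hr]
    rw [← Measure.pi_map_pi fun i => (measurable_const_mul _).aemeasurable,
      Measure.map_apply (by fun_prop) hP, dirichlet, Measure.map_apply measurable_proportions hB]
    congr 1
    ext x
    simp only [Set.mem_preimage, ← Finset.mul_sum, mul_div_mul_left _ _ (inv_pos.2 hr).ne']
  rw [pi_gammaMeasure_eq_withDensity_exp hn hr, withDensity_apply _ hP] at hscale
  simp_rw [sub_sub_cancel, ENNReal.ofReal_mul (Real.rpow_nonneg hr.le _)] at hscale
  rw [lintegral_const_mul _ (by fun_prop)] at hscale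
  rw [← hscale, ← mul_assoc, ← ENNReal.ofReal_mul (Real.rpow_nonneg hr.le _),
    ← Real.rpow_add hr, neg_add_cancel, Real.rpow_zero, ENNReal.ofReal_one, one_mul]

/-- The total has mean at most `∑ i, n i` on every event that depends only on the proportions. -/
theorem setLIntegral_total_le {n : S → ℝ} (hn : ∀ i, 0 < n i)
    {B : Set (S → ℝ)} (hB : MeasurableSet B) :
    ∫⁻ x in (fun (x : S → ℝ) i => x i / ∑ j, x j) ⁻¹' B, ENNReal.ofReal (∑ i, x i)
        ∂(Measure.pi fun i => gammaMeasure (n i) 1) ≤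
      ENNReal.ofReal (∑ i, n i) * dirichlet n B := by
  have := fun i => isProbabilityMeasure_gammaMeasure (hn i) one_pos
  have := isProbabilityMeasure_dirichlet hn
  set μ := Measure.pi fun i => gammaMeasure (n i) 1
  set P := (fun (x : S → ℝ) i => x i / ∑ j, x j) ⁻¹' B
  set N := ∑ i, n i
  have hN : 0 ≤ N := Finset.sum_nonneg fun i _ => (hn i).le
  have hμP : μ P = dirichlet n B := (Measure.map_apply measurable_proportions hB).symm
  have hnn : ∀ᵐ x ∂μ.restrict P, 0 ≤ ∑ i, x i :=
    ae_restrict_of_ae ((ae_nonneg_pi_gammaMeasure hn).mono fun x hx =>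
      Finset.sum_nonneg fun i _ => hx i)
  -- Integrate `1 + ε * T ≤ exp (ε * T)` over the event, `T` being the total.
  have key : ∀ ε : ℝ, 0 < ε → ε < 1 →
      dirichlet n B + ENNReal.ofReal ε * ∫⁻ x in P, ENNReal.ofReal (∑ i, x i) ∂μ ≤
        ENNReal.ofReal ((1 - ε) ^ (-N)) * dirichlet n B := fun ε h0 h1 => by
    rw [← setLIntegral_exp_total hn h1 hB, ← lintegral_const_mul _ (by fun_prop), ← hμP,
      ← setLIntegral_one, ← lintegral_add_left measurable_const]
    refine lintegral_mono_ae (hnn.mono fun x hx => ?_)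
    rw [← ENNReal.ofReal_mul h0.le, ← ENNReal.ofReal_one,
      ← ENNReal.ofReal_add zero_le_one (mul_nonneg h0.le hx), add_comm]
    exact ENNReal.ofReal_le_ofReal (Real.add_one_le_exp _)
  have hBtop : dirichlet n B ≠ ∞ := measure_ne_top _ _
  have hI : ∫⁻ x in P, ENNReal.ofReal (∑ i, x i) ∂μ ≠ ∞ := fun h => by
    have := key (1 / 2) (by norm_num) (by norm_num)
    rw [h, ENNReal.mul_top (by norm_num), add_top, top_le_iff] at this
    exact ENNReal.mul_ne_top ENNReal.ofReal_ne_top hBtop this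
  set I := ∫⁻ x in P, ENNReal.ofReal (∑ i, x i) ∂μ
  -- At `ε = 0` the upper bound in `key` equals `dirichlet n B`, so its right slope there bounds the
  -- mean of the total.
  have hd : HasDerivAt (fun ε : ℝ => (1 - ε) ^ (-N) * (dirichlet n B).toReal)
      (N * (dirichlet n B).toReal) 0 := by
    have h := (((hasDerivAt_id (0 : ℝ)).const_sub 1).rpow_const (p := -N)
      (Or.inl (by norm_num))).mul_const (dirichlet n B).toReal
    simpa using h
  have hle : I.toReal ≤ N * (dirichlet n B).toReal := by
    refine ge_of_tendsto hd.tendsto_slope_zero_right ?_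
    filter_upwards [Ioo_mem_nhdsGT (zero_lt_one' ℝ)] with ε hε
    have h := ENNReal.toReal_mono (ENNReal.mul_ne_top ENNReal.ofReal_ne_top hBtop)
      (key ε hε.1 hε.2)
    rw [ENNReal.toReal_add hBtop (ENNReal.mul_ne_top ENNReal.ofReal_ne_top hI),
      ENNReal.toReal_mul, ENNReal.toReal_mul, ENNReal.toReal_ofReal hε.1.le,
      ENNReal.toReal_ofReal (Real.rpow_nonneg (sub_pos.2 hε.2).le _)] at h
    rw [zero_add, sub_zero, Real.one_rpow, one_mul, smul_eq_mul, inv_mul_eq_div,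
      le_div_iff₀ hε.1]
    linarith
  rw [← ENNReal.ofReal_toReal hI, ← ENNReal.ofReal_toReal hBtop, ← ENNReal.ofReal_mul hN]
  exact ENNReal.ofReal_le_ofReal hle

/-- The posterior after observing `s` is dominated by the prior, with the inverse of the
predictive probability of `s` as constant. -/
theorem dirichlet_update_le [DecidableEq S] {n : S → ℝ} (hn : ∀ i, 0 < n i) (s : S) :
    dirichlet (Function.update n s (n s + 1)) ≤
      ENNReal.ofReal ((∑ i, n i) / n s) • dirichlet n := by
  refine Measure.le_iff.2 fun B hB => ?_
  have hP := measurable_proportions hB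
  rw [dirichlet, Measure.map_apply measurable_proportions hB, pi_gammaMeasure_update_add_one hn,
    withDensity_apply _ hP, Measure.smul_apply, smul_eq_mul, div_eq_inv_mul,
    ENNReal.ofReal_mul (inv_nonneg.2 (hn s).le), mul_assoc]
  refine le_trans ?_ (mul_le_mul_right (setLIntegral_total_le hn hB) _)
  rw [← lintegral_const_mul _ (by fun_prop)]
  refine lintegral_mono_ae (ae_restrict_of_ae ((ae_nonneg_pi_gammaMeasure hn).mono fun x hx => ?_))
  rw [← ENNReal.ofReal_mul (inv_nonneg.2 (hn s).le), ← div_eq_inv_mul]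
  exact ENNReal.ofReal_le_ofReal (div_le_div_of_nonneg_right
    (Finset.single_le_sum (fun i _ => hx i) (Finset.mem_univ s)) (hn s).le)

end Dirichlet

/-- The density of `μ` is at most `C` almost everywhere, so the log-likelihood ratio is at most `log
C`. -/
theorem klDiv_le_log_of_le_smul {Ω : Type*} [MeasurableSpace Ω] {μ ν : Measure Ω}
    [IsProbabilityMeasure μ] [IsProbabilityMeasure ν] {C : ℝ} (hC : 0 ≤ C)
    (h : μ ≤ ENNReal.ofReal C • ν) :
    InformationTheory.klDiv μ ν ≤ ENNReal.ofReal (Real.log C) := by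
  have hac : μ ≪ ν := (Measure.absolutelyContinuous_of_le h).trans
    Measure.smul_absolutelyContinuous
  have hbd : μ.rnDeriv ν ≤ᵐ[ν] fun _ => ENNReal.ofReal C := by
    refine ae_le_of_forall_setLIntegral_le_of_sigmaFinite (μ.measurable_rnDeriv ν) fun s _ _ => ?_
    rw [setLIntegral_const]
    exact (Measure.setLIntegral_rnDeriv_le s).trans (h s)
  have hbd' : ∀ᵐ x ∂ν, (μ.rnDeriv ν x).toReal ≤ C := hbd.mono fun x hx =>
    (ENNReal.toReal_mono ENNReal.ofReal_ne_top hx).trans_eq (ENNReal.toReal_ofReal hC)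
  obtain ⟨K, hK⟩ := (isCompact_Icc (a := (0 : ℝ)) (b := C)).exists_bound_of_continuousOn
    InformationTheory.continuous_klFun.continuousOn
  -- The density lies in `[0, C]`, where `klFun` is bounded by compactness.
  have hint : Integrable (llr μ ν) μ := by
    rw [← InformationTheory.integrable_klFun_rnDeriv_iff hac]
    refine Integrable.of_bound (C := K) ?_ (hbd'.mono fun x hx => hK _ ⟨ENNReal.toReal_nonneg, hx⟩)
    exact (InformationTheory.continuous_klFun.measurable.comp
      (μ.measurable_rnDeriv ν).ennreal_toReal).aestronglyMeasurable
  rw [← ENNReal.ofReal_toReal (InformationTheory.klDiv_ne_top hac hint),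
    InformationTheory.toReal_klDiv_of_measure_eq hac (by simp)]
  refine ENNReal.ofReal_le_ofReal ?_
  calc ∫ x, llr μ ν x ∂μ ≤ ∫ _, Real.log C ∂μ := by
        refine integral_mono_ae hint (integrable_const _) ?_
        filter_upwards [hac.ae_le hbd', Measure.rnDeriv_pos hac,
          hac.ae_le (Measure.rnDeriv_lt_top μ ν)] with x h1 h2 h3
        exact Real.log_le_log (ENNReal.toReal_pos h2.ne' h3.ne) h1
    _ = Real.log C := by simp

/-! ### Uniform bound on the information gain -/

section Gain

variable {S : Type*} [Fintype S] [DecidableEq S]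

theorem gain_nonneg {n : S → ℝ} (hn : ∀ i, 0 < n i) : 0 ≤ gain n :=
  Finset.sum_nonneg fun s _ => mul_nonneg
    (div_nonneg (hn s).le (Finset.sum_nonneg fun i _ => (hn i).le)) ENNReal.toReal_nonneg

/-- The expected information gain is bounded uniformly in the parameters. -/
theorem gain_le_card {n : S → ℝ} (hn : ∀ i, 0 < n i) : gain n ≤ Fintype.card S := by
  have hterm : ∀ s ∈ Finset.univ, n s / (∑ i, n i) * (InformationTheory.klDiv
      (dirichlet (Function.update n s (n s + 1))) (dirichlet n)).toReal ≤ 1 := fun s _ => by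
    have hle : n s ≤ ∑ i, n i :=
      Finset.single_le_sum (fun i _ => (hn i).le) (Finset.mem_univ s)
    have hN : 0 < ∑ i, n i := (hn s).trans_le hle
    have hp : 0 < n s / ∑ i, n i := div_pos (hn s) hN
    have hpos : ∀ i, 0 < Function.update n s (n s + 1) i := fun i => by
      rcases eq_or_ne i s with rfl | h
      · rw [Function.update_self]; linarith [hn i]
      · rw [Function.update_of_ne h]; exact hn i
    have := isProbabilityMeasure_dirichlet hn
    have := isProbabilityMeasure_dirichlet hpos
    have hC : 0 < (∑ i, n i) / n s := div_pos hN (hn s)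
    have hkl := ENNReal.toReal_mono ENNReal.ofReal_ne_top
      (klDiv_le_log_of_le_smul hC.le (dirichlet_update_le hn s))
    rw [ENNReal.toReal_ofReal (Real.log_nonneg ((one_le_div (hn s)).2 hle))] at hkl
    -- By `log x ≤ x - 1` at `x = 1 / p`, the weight `p` cancels.
    calc _ ≤ n s / (∑ i, n i) * ((∑ i, n i) / n s) := by
          refine mul_le_mul_of_nonneg_left (hkl.trans ?_) hp.le
          linarith [Real.log_le_sub_one_of_pos hC]
      _ = 1 := by rw [div_mul_div_cancel₀ hN.ne', div_self (hn s).ne']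
  simpa [gain] using Finset.sum_le_sum hterm

end Gain

/-! ### Discounted recursion: limits, uniqueness, comparison with policies -/

section Recursion

variable {S A : Type*}

theorem Positive.observe [DecidableEq S] [DecidableEq A] {α : S → A → S → ℝ} (hα : Positive α)
    (s : S) (a : A) (s' : S) : Positive (observe α s a s') := fun x b y => by
  unfold Curiosity.observe
  split_ifs
  · linarith [hα x b y]
  · exact hα x b y

section MaxAction

variable [Fintype A] [Nonempty A]

theorem le_maxAction (f : A → ℝ) (a : A) : f a ≤ maxAction f :=
  Finset.le_sup' f (Finset.mem_univ a)

theorem maxAction_le {f : A → ℝ} {c : ℝ} (h : ∀ a, f a ≤ c) : maxAction f ≤ c :=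
  Finset.sup'_le _ _ fun a _ => h a

theorem abs_maxAction_sub_le {f g : A → ℝ} {c : ℝ} (h : ∀ a, |f a - g a| ≤ c) :
    |maxAction f - maxAction g| ≤ c := by
  have h1 : maxAction f ≤ maxAction g + c := maxAction_le fun a => by
    linarith [(abs_le.1 (h a)).2, le_maxAction g a]
  have h2 : maxAction g ≤ maxAction f + c := maxAction_le fun a => by
    linarith [(abs_le.1 (h a)).1, le_maxAction f a]
  exact abs_le.2 ⟨by linarith, by linarith⟩

theorem tendsto_maxAction {f : ℕ → A → ℝ} {g : A → ℝ}
    (h : ∀ a, Tendsto (fun τ => f τ a) atTop (𝓝 (g a))) :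
    Tendsto (fun τ => maxAction (f τ)) atTop (𝓝 (maxAction g)) :=
  Tendsto.finset_sup'_nhds_apply (f := fun a τ => f τ a) Finset.univ_nonempty fun a _ => h a

end MaxAction

section Pred

variable [Fintype S] {α : S → A → S → ℝ}

theorem pred_nonneg (hα : Positive α) (s : S) (a : A) (s' : S) : 0 ≤ pred α s a s' :=
  div_nonneg (hα s a s').le (Finset.sum_nonneg fun x _ => (hα s a x).le)

theorem sum_pred (hα : Positive α) (s : S) (a : A) : ∑ s', pred α s a s' = 1 := by
  -- The state `s` itself witnesses that `S` is nonempty.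
  have h : 0 < ∑ x, α s a x := Finset.sum_pos (fun x _ => hα s a x) ⟨s, Finset.mem_univ s⟩
  simp only [pred, ← Finset.sum_div]
  exact div_self h.ne'

theorem sum_pred_mul_le (hα : Positive α) (s : S) (a : A) {f : S → ℝ} {c : ℝ} (h : ∀ s', f s' ≤ c) :
    ∑ s', pred α s a s' * f s' ≤ c := by
  calc ∑ s', pred α s a s' * f s' ≤ ∑ s', pred α s a s' * c :=
        Finset.sum_le_sum fun s' _ => mul_le_mul_of_nonneg_left (h s') (pred_nonneg hα s a s')
    _ = c := by rw [← Finset.sum_mul, sum_pred hα, one_mul]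

theorem sum_pred_mul_mono (hα : Positive α) (s : S) (a : A) {f g : S → ℝ} (h : ∀ s', f s' ≤ g s') :
    ∑ s', pred α s a s' * f s' ≤ ∑ s', pred α s a s' * g s' :=
  Finset.sum_le_sum fun s' _ => mul_le_mul_of_nonneg_left (h s') (pred_nonneg hα s a s')

theorem abs_sum_pred_mul_sub_le (hα : Positive α) (s : S) (a : A) {f g : S → ℝ} {c : ℝ} (h : ∀ s', |f s' - g s'| ≤ c) :
    |∑ s', pred α s a s' * f s' - ∑ s', pred α s a s' * g s'| ≤ c := by
  rw [← Finset.sum_sub_distrib]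
  simp_rw [← mul_sub]
  refine (Finset.abs_sum_le_sum_abs _ _).trans ?_
  simp_rw [abs_mul, fun s' => abs_of_nonneg (pred_nonneg hα s a s')]
  exact sum_pred_mul_le hα s a h

end Pred

variable [Fintype S] [DecidableEq S] [Fintype A] [DecidableEq A] {γ : ℝ}

/-- `B / (1 - γ)` is the fixed point of `y ↦ B + γ * y`, hence a bound preserved by each step of the
recursion. -/
theorem add_mul_le_div_one_sub (hγ0 : 0 ≤ γ) (hγ1 : γ < 1) {B x y : ℝ} (hx : x ≤ B)
    (hy : y ≤ B / (1 - γ)) : x + γ * y ≤ B / (1 - γ) := by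
  have h := mul_le_mul_of_nonneg_left hy hγ0
  have : B + γ * (B / (1 - γ)) = B / (1 - γ) := by
    have := (sub_pos.2 hγ1).ne'
    field_simp
    ring
  linarith

theorem card_div_one_sub_nonneg (S : Type*) [Fintype S] (hγ1 : γ < 1) :
    0 ≤ (Fintype.card S : ℝ) / (1 - γ) :=
  div_nonneg (Nat.cast_nonneg _) (sub_pos.2 hγ1).le

section Optimal

variable [Nonempty A]

theorem optQ_nonneg (hγ0 : 0 ≤ γ) (τ : ℕ) {α : S → A → S → ℝ} (hα : Positive α) (s : S) (a : A) :
    0 ≤ optQ γ τ α s a := by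
  induction τ generalizing α s a with
  | zero => exact le_rfl
  | succ τ ih =>
    exact add_nonneg (gain_nonneg (hα s a)) (mul_nonneg hγ0 (Finset.sum_nonneg fun s' _ =>
      mul_nonneg (pred_nonneg hα s a s')
        ((ih (hα.observe s a s') s' (Classical.arbitrary A)).trans (le_maxAction _ _))))

theorem optQ_le (hγ0 : 0 ≤ γ) (hγ1 : γ < 1) (τ : ℕ) {α : S → A → S → ℝ} (hα : Positive α)
    (s : S) (a : A) : optQ γ τ α s a ≤ Fintype.card S / (1 - γ) := by
  induction τ generalizing α s a with
  | zero => exact card_div_one_sub_nonneg S hγ1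
  | succ τ ih =>
    exact add_mul_le_div_one_sub hγ0 hγ1 (gain_le_card (hα s a))
      (sum_pred_mul_le hα s a fun s' => maxAction_le fun a' => ih (hα.observe s a s') s' a')

theorem optQ_le_succ (hγ0 : 0 ≤ γ) (τ : ℕ) {α : S → A → S → ℝ} (hα : Positive α)
    (s : S) (a : A) : optQ γ τ α s a ≤ optQ γ (τ + 1) α s a := by
  induction τ generalizing α s a with
  | zero => exact optQ_nonneg hγ0 1 hα s a
  | succ τ ih =>
    exact add_le_add_right (mul_le_mul_of_nonneg_left (sum_pred_mul_mono hα s a fun s' =>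
      maxAction_le fun a' => (ih (hα.observe s a s') s' a').trans
        (le_maxAction (fun a' => optQ γ (τ + 1) (observe α s a s') s' a') a')) hγ0) _

/-- Monotone bounded convergence makes `limUnder` a genuine limit rather than a default value. -/
theorem tendsto_optQ (hγ0 : 0 ≤ γ) (hγ1 : γ < 1) {α : S → A → S → ℝ} (hα : Positive α)
    (s : S) (a : A) : Tendsto (fun τ => optQ γ τ α s a) atTop (𝓝 (optQLim γ α s a)) :=
  tendsto_nhds_limUnder ⟨_, tendsto_atTop_ciSup
    (monotone_nat_of_le_succ fun τ => optQ_le_succ hγ0 τ hα s a)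
    ⟨_, Set.forall_mem_range.2 fun τ => optQ_le hγ0 hγ1 τ hα s a⟩⟩

theorem solvesRecursion_optQLim (hγ0 : 0 ≤ γ) (hγ1 : γ < 1) :
    SolvesRecursion γ (optQLim (S := S) (A := A) γ) := fun α hα s a => by
  -- The values at horizon `τ + 1` have both sides of the recursion as limit.
  refine tendsto_nhds_unique ((tendsto_add_atTop_iff_nat 1).2 (tendsto_optQ hγ0 hγ1 hα s a)) ?_
  exact ((tendsto_finsetSum _ fun s' _ => (tendsto_maxAction fun a' =>
    tendsto_optQ hγ0 hγ1 (hα.observe s a s') s' a').const_mul _).const_mul γ).const_add _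

theorem boundedFamily_optQLim (hγ0 : 0 ≤ γ) (hγ1 : γ < 1) :
    BoundedFamily (optQLim (S := S) (A := A) γ) :=
  ⟨Fintype.card S / (1 - γ), fun α hα s a => by
    have h := tendsto_optQ hγ0 hγ1 hα s a
    rw [abs_of_nonneg (ge_of_tendsto' h fun τ => optQ_nonneg hγ0 τ hα s a)]
    exact le_of_tendsto' h fun τ => optQ_le hγ0 hγ1 τ hα s a⟩

/-- Value iteration converges geometrically to every bounded solution of the recursion. -/
theorem SolvesRecursion.abs_sub_optQ_le {Q : (S → A → S → ℝ) → S → A → ℝ}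
    (hQ : SolvesRecursion γ Q) (hγ0 : 0 ≤ γ) {C : ℝ}
    (hC : ∀ α, Positive α → ∀ s a, |Q α s a| ≤ C) (τ : ℕ) {α : S → A → S → ℝ} (hα : Positive α)
    (s : S) (a : A) : |Q α s a - optQ γ τ α s a| ≤ γ ^ τ * C := by
  induction τ generalizing α s a with
  | zero => simpa [optQ] using hC α hα s a
  | succ τ ih =>
    rw [hQ α hα s a, optQ, add_sub_add_left_eq_sub, ← mul_sub, abs_mul, abs_of_nonneg hγ0,
      pow_succ', mul_assoc]
    exact mul_le_mul_of_nonneg_left (abs_sum_pred_mul_sub_le hα s a fun s' =>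
      abs_maxAction_sub_le fun a' => ih (hα.observe s a s') s' a') hγ0

theorem SolvesRecursion.eq_optQLim {Q : (S → A → S → ℝ) → S → A → ℝ}
    (hQ : SolvesRecursion γ Q) (hb : BoundedFamily Q) (hγ0 : 0 ≤ γ) (hγ1 : γ < 1)
    {α : S → A → S → ℝ} (hα : Positive α) (s : S) (a : A) : Q α s a = optQLim γ α s a := by
  obtain ⟨C, hC⟩ := hb
  refine tendsto_nhds_unique (tendsto_iff_dist_tendsto_zero.2 ?_) (tendsto_optQ hγ0 hγ1 hα s a)
  refine squeeze_zero (fun _ => dist_nonneg) (fun τ => ?_)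
    (by simpa using (tendsto_pow_atTop_nhds_zero_of_lt_one hγ0 hγ1).mul_const C)
  rw [dist_comm, Real.dist_eq]
  exact hQ.abs_sub_optQ_le hγ0 hC τ hα s a

end Optimal

section Policies

theorem policyQ_nonneg (hγ0 : 0 ≤ γ) (τ : ℕ) (π : Policy S A) {α : S → A → S → ℝ}
    (hα : Positive α) (s : S) (a : A) : 0 ≤ policyQ γ τ π α s a := by
  induction τ generalizing π α s a with
  | zero => exact le_rfl
  | succ τ ih =>
    exact add_nonneg (gain_nonneg (hα s a)) (mul_nonneg hγ0 (Finset.sum_nonneg fun s' _ =>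
      mul_nonneg (pred_nonneg hα s a s') (Finset.sum_nonneg fun a' _ =>
        mul_nonneg (π.nonneg _ _ _) (ih _ (hα.observe s a s') s' a'))))

theorem policyQ_le_succ (hγ0 : 0 ≤ γ) (τ : ℕ) (π : Policy S A) {α : S → A → S → ℝ}
    (hα : Positive α) (s : S) (a : A) : policyQ γ τ π α s a ≤ policyQ γ (τ + 1) π α s a := by
  induction τ generalizing π α s a with
  | zero => exact policyQ_nonneg hγ0 1 π hα s a
  | succ τ ih =>
    exact add_le_add_right (mul_le_mul_of_nonneg_left (sum_pred_mul_mono hα s a fun s' =>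
      Finset.sum_le_sum fun a' _ => mul_le_mul_of_nonneg_left
        (ih (π.after s a s') (hα.observe s a s') s' a') (π.nonneg _ _ _)) hγ0) _

variable [Nonempty A]

theorem policyQ_le_optQ (hγ0 : 0 ≤ γ) (τ : ℕ) (π : Policy S A) {α : S → A → S → ℝ}
    (hα : Positive α) (s : S) (a : A) : policyQ γ τ π α s a ≤ optQ γ τ α s a := by
  -- The policy must vary too: the continuation follows `π.after s a s'`.
  induction τ generalizing π α s a with
  | zero => exact le_rfl
  | succ τ ih =>
    refine add_le_add_right (mul_le_mul_of_nonneg_left (sum_pred_mul_mono hα s a fun s' => ?_)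
      hγ0) _
    set M := maxAction fun a' => optQ γ τ (observe α s a s') s' a'
    calc _ ≤ ∑ a', π.prob [(s, a, s')] s' a' * M :=
          Finset.sum_le_sum fun a' _ => mul_le_mul_of_nonneg_left
            ((ih (π.after s a s') (hα.observe s a s') s' a').trans
              (le_maxAction (fun a' => optQ γ τ (observe α s a s') s' a') a')) (π.nonneg _ _ _)
      _ = M := by rw [← Finset.sum_mul, π.sum_one, one_mul]

theorem tendsto_policyQ (hγ0 : 0 ≤ γ) (hγ1 : γ < 1) (π : Policy S A) {α : S → A → S → ℝ}
    (hα : Positive α) (s : S) (a : A) :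
    Tendsto (fun τ => policyQ γ τ π α s a) atTop (𝓝 (policyQLim γ π α s a)) :=
  tendsto_nhds_limUnder ⟨_, tendsto_atTop_ciSup
    (monotone_nat_of_le_succ fun τ => policyQ_le_succ hγ0 τ π hα s a)
    ⟨_, Set.forall_mem_range.2 fun τ =>
      (policyQ_le_optQ hγ0 τ π hα s a).trans (optQ_le hγ0 hγ1 τ hα s a)⟩⟩

theorem policyQLim_le_optQLim (hγ0 : 0 ≤ γ) (hγ1 : γ < 1) (π : Policy S A)
    {α : S → A → S → ℝ} (hα : Positive α) (s : S) (a : A) :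
    policyQLim γ π α s a ≤ optQLim γ α s a :=
  le_of_tendsto_of_tendsto' (tendsto_policyQ hγ0 hγ1 π hα s a) (tendsto_optQ hγ0 hγ1 hα s a)
    fun τ => policyQ_le_optQ hγ0 τ π hα s a

end Policies

end Recursion

end Curiosity

theorem mainTheorem4 {S A : Type*} [Fintype S] [DecidableEq S] [Fintype A] [DecidableEq A]
    [Nonempty A] (γ : ℝ) (hγ0 : 0 ≤ γ) (hγ1 : γ < 1) :
    -- the limit `q_α^γ` exists
    (∀ α : S → A → S → ℝ, Curiosity.Positive α → ∀ s a,
      Tendsto (fun τ => Curiosity.optQ γ τ α s a) atTop (𝓝 (Curiosity.optQLim γ α s a))) ∧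
    -- it is the (unique bounded) solution of the infinite recursion
    Curiosity.SolvesRecursion γ (Curiosity.optQLim (S := S) (A := A) γ) ∧
    Curiosity.BoundedFamily (Curiosity.optQLim (S := S) (A := A) γ) ∧
    (∀ Q : (S → A → S → ℝ) → S → A → ℝ,
      Curiosity.SolvesRecursion γ Q → Curiosity.BoundedFamily Q →
      ∀ α, Curiosity.Positive α → ∀ s a, Q α s a = Curiosity.optQLim γ α s a) ∧
    -- it dominates the limiting curiosity Q-value of every policy
    (∀ (π : Curiosity.Policy S A) (α : S → A → S → ℝ), Curiosity.Positive α → ∀ s a,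
      Tendsto (fun τ => Curiosity.policyQ γ τ π α s a) atTop
        (𝓝 (Curiosity.policyQLim γ π α s a)) ∧
      Curiosity.policyQLim γ π α s a ≤ Curiosity.optQLim γ α s a) := by
  exact ⟨fun α hα => Curiosity.tendsto_optQ hγ0 hγ1 hα,
    Curiosity.solvesRecursion_optQLim hγ0 hγ1, Curiosity.boundedFamily_optQLim hγ0 hγ1,
    fun Q hQ hb α hα => hQ.eq_optQLim hb hγ0 hγ1 hα,
    fun π α hα s a => ⟨Curiosity.tendsto_policyQ hγ0 hγ1 π hα s a,
      Curiosity.policyQLim_le_optQLim hγ0 hγ1 π hα s a⟩⟩
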